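/- Let $F$ be a finite graph with at least one edge and no isolated vertices. In the achievement game of $F$ on the complete graph $K_n$, two players, Alice and Bob, alternately choose an uncolored edge of $K_n$, Alice moving first; Alice colors her edges blue and Bob colors his edges red. The player who first completes a copy of $F$ (as a not necessarily induced subgraph) in his or her own color wins; if all edges are colored and neither player has completed a copy, nobody wins. The achievement number $a(F)$ is the smallest $n$ for which Alice has a winning strategy. Let $mK_2$ denote the matching consisting of $m$ pairwise disjoint edges. **Theorem.** For every integer $m\ge 1$, $$ a(mK_2)=\begin{cases}5, & m=2;\\ 2m, & m\neq 2.\end{cases} $$ -/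

import Mathlib

namespace AchievementGame

variable {V W : Type*}

/-- A record of a game: the edges chosen so far, most recent first.
Alice (blue) moves first and the players alternate, so the edge on top of `h` was
chosen by Alice exactly when `h` has even length. -/
abbrev History (V : Type*) := List (Sym2 V)

/-- The blue edges (those chosen by Alice). -/
def blue : History V → Set (Sym2 V)
  | [] => ∅
  | e :: h => if Even h.length then insert e (blue h) else blue h

/-- The red edges (those chosen by Bob). -/
def red : History V → Set (Sym2 V)
  | [] => ∅
  | e :: h => if Even h.length then red h else insert e (red h)

/-- `e` is an uncolored edge of the board `G` after the moves `h`. -/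
def IsUncolored (G : SimpleGraph V) (h : History V) (e : Sym2 V) : Prop :=
  e ∈ G.edgeSet ∧ e ∉ h

/-- A strategy (for either player) tells which edge to choose after every record of moves. -/
abbrev Strategy (V : Type*) := History V → Sym2 V

/-- A strategy is legal on the board `G` if it always chooses an uncolored edge of `G`,
as long as there is one. -/
def Strategy.IsLegal (G : SimpleGraph V) (s : Strategy V) : Prop :=
  ∀ h : History V, (∃ e, IsUncolored G h e) → IsUncolored G h (s h)

open Classical in
/-- The record after `t` moves when Alice follows `σ` and Bob follows `τ`. The play stops
when all edges are colored; moves made after one of the players has completed his copy are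
harmless, since only the player who was first counts. -/
noncomputable def play (G : SimpleGraph V) (σ τ : Strategy V) : ℕ → History V
  | 0 => []
  | t + 1 =>
    let h := play G σ τ t
    if ∃ e, IsUncolored G h e then
      (if Even h.length then σ h else τ h) :: h
    else h

/-- The edge set `E` contains a copy of `F`, as a not necessarily induced subgraph. -/
def ContainsCopy (F : SimpleGraph W) (E : Set (Sym2 V)) : Prop :=
  F.IsContained (SimpleGraph.fromEdgeSet E)

/-- Alice is the first to complete a copy of `F` in her color: at some moment
there is a blue copy of `F` but no red one. -/
def AliceWins (F : SimpleGraph W) (G : SimpleGraph V) (σ τ : Strategy V) : Prop :=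
  ∃ t, ContainsCopy F (blue (play G σ τ t)) ∧ ¬ ContainsCopy F (red (play G σ τ t))

/-- Alice has a winning strategy in the achievement game of `F` on the board `G`. -/
def AliceHasWinningStrategy (F : SimpleGraph W) (G : SimpleGraph V) : Prop :=
  ∃ σ : Strategy V, σ.IsLegal G ∧ ∀ τ : Strategy V, τ.IsLegal G → AliceWins F G σ τ

/-- `a` is the achievement number of `F`: the smallest `n` such that Alice has a winning
strategy in the achievement game of `F` on the complete graph with `n` vertices. -/
def IsAchievementNumber (F : SimpleGraph W) (a : ℕ) : Prop :=
  IsLeast {n : ℕ | AliceHasWinningStrategy F (⊤ : SimpleGraph (Fin n))} a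

/-- The matching `mK₂`: `m` disjoint edges, the `i`-th one joining `(i, 0)` and `(i, 1)`. -/
def matching (m : ℕ) : SimpleGraph (Fin m × Fin 2) where
  Adj x y := x.1 = y.1 ∧ x.2 ≠ y.2
  symm := ⟨fun _ _ h => ⟨h.1.symm, h.2.symm⟩⟩
  loopless := ⟨fun _ h => h.2 rfl⟩

end AchievementGame

/-! A copy of `mK₂` needs `2m` vertices, so only `m = 2` can deviate from `2m`. On `K₄` the three
perfect matchings partition the edges into pairs; Bob always takes the partner of Alice's edge, so
she never owns a pair. On `K₅`, after Alice's first edge three vertices remain, and Bob cannot spoil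
the whole triangle on them with one edge. For `m ≥ 3` on `2m` vertices, Bob's first edge `aa'` has
an end `a` off Alice's first edge. Alice plays disjoint edges avoiding `a`, always killing the at
most one red edge among the uncovered vertices. With four vertices `a, b, c, d` left she plays `bc`,
forcing `ad`. Her matching `M` then misses only `a` and `d`. For a suitable edge `x₁y₁` of `M` she
plays `dx₁`, threatening `ay₁`; Bob must take it. For another edge `xy` of `M` she plays `ax`,
threatening both `dy` (keeping `x₁y₁`) and `y₁y` (using `dx₁` instead), and Bob can block only one.
The forced replies all pass through `a`. A red matching uses at most one of them, so Bob is too slow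
to finish first (`not_containsCopy_of_star`). Suitable edges exist by counting: bad choices inject
into red edges, of which there are too few. -/

namespace AchievementGame

variable {V W : Type*}

/-! ### Forced wins as an inductive predicate on positions, and the resulting strategies -/

section Forcing

/-- In the position with blue edges `B` and red edges `R`, Alice is to move and can force a win. -/
inductive AliceForces (F : SimpleGraph W) (G : SimpleGraph V) :
    Set (Sym2 V) → Set (Sym2 V) → Prop
  | finish {B R : Set (Sym2 V)} (e : Sym2 V) (he : e ∈ G.edgeSet) (heB : e ∉ B) (heR : e ∉ R)
      (hB : ContainsCopy F (insert e B)) (hR : ¬ ContainsCopy F R) : AliceForces F G B R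
  | move {B R : Set (Sym2 V)} (e : Sym2 V) (he : e ∈ G.edgeSet) (heB : e ∉ B) (heR : e ∉ R)
      -- Bob must have a reply: on a full board `h` would hold vacuously and a draw would count as a
      -- win.
      (hex : ∃ f ∈ G.edgeSet, f ∉ insert e B ∧ f ∉ R)
      (h : ∀ f ∈ G.edgeSet, f ∉ insert e B → f ∉ R →
        AliceForces F G (insert e B) (insert f R)) : AliceForces F G B R

theorem mem_iff_blue_or_red (h : History V) (e : Sym2 V) : e ∈ h ↔ e ∈ blue h ∨ e ∈ red h := by
  induction h with
  | nil => simp [blue, red]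
  | cons f h ih =>
    by_cases hh : Even h.length <;> simp only [blue, red, hh, if_true, if_false, List.mem_cons,
      Set.mem_insert_iff, ih] <;> tauto

theorem play_succ_of_even {G : SimpleGraph V} {σ τ : Strategy V} {t : ℕ}
    (hex : ∃ e, IsUncolored G (play G σ τ t) e) (hev : Even (play G σ τ t).length) :
    play G σ τ (t + 1) = σ (play G σ τ t) :: play G σ τ t := by
  simp only [play, if_pos hex, if_pos hev]

theorem play_succ_of_not_even {G : SimpleGraph V} {σ τ : Strategy V} {t : ℕ}
    (hex : ∃ e, IsUncolored G (play G σ τ t) e) (hev : ¬ Even (play G σ τ t).length) :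
    play G σ τ (t + 1) = τ (play G σ τ t) :: play G σ τ t := by
  simp only [play, if_pos hex, if_neg hev]

theorem play_succ_of_full {G : SimpleGraph V} {σ τ : Strategy V} {t : ℕ}
    (hex : ¬ ∃ e, IsUncolored G (play G σ τ t) e) :
    play G σ τ (t + 1) = play G σ τ t := by
  simp only [play, if_neg hex]

/-- A move by which Alice wins at once or keeps a forced win. -/
def IsGoodMove (F : SimpleGraph W) (G : SimpleGraph V) (h : History V) (e : Sym2 V) : Prop :=
  IsUncolored G h e ∧
    ((ContainsCopy F (insert e (blue h)) ∧ ¬ ContainsCopy F (red h)) ∨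
      ((∃ f, IsUncolored G (e :: h) f) ∧ ∀ f, IsUncolored G (e :: h) f →
        AliceForces F G (insert e (blue h)) (insert f (red h))))

theorem AliceForces.exists_isGoodMove {F : SimpleGraph W} {G : SimpleGraph V} {h : History V}
    (hf : AliceForces F G (blue h) (red h)) : ∃ e, IsGoodMove F G h e := by
  have key : ∀ e f : Sym2 V, f ∉ e :: h ↔ f ∉ insert e (blue h) ∧ f ∉ red h := fun e f => by
    rw [List.mem_cons, mem_iff_blue_or_red, Set.mem_insert_iff]; tauto
  cases hf with
  | finish e he heB heR hB hR =>
    exact ⟨e, ⟨he, by rw [mem_iff_blue_or_red]; tauto⟩, Or.inl ⟨hB, hR⟩⟩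
  | move e he heB heR hex hm =>
    refine ⟨e, ⟨he, by rw [mem_iff_blue_or_red]; tauto⟩, Or.inr ⟨?_, ?_⟩⟩
    · obtain ⟨f, hf, hf'⟩ := hex
      exact ⟨f, hf, (key e f).2 hf'⟩
    · rintro f ⟨hf, hf'⟩
      exact hm f hf ((key e f).1 hf').1 ((key e f).1 hf').2

open Classical in
-- Alice picks any good move, not necessarily the one in the derivation of `hf`. Termination
-- therefore comes from the decreasing number of uncolored edges, not from induction on
-- `AliceForces`.
theorem AliceForces.hasWinningStrategy [Finite V] {F : SimpleGraph W} {G : SimpleGraph V}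
    (hf : AliceForces F G ∅ ∅) : AliceHasWinningStrategy F G := by
  obtain ⟨e₀, -⟩ := AliceForces.exists_isGoodMove (h := ([] : History V)) hf
  -- The second branch makes `σ` legal at every record, even unreachable ones; `e₀` is a junk value
  -- for full boards.
  let σ : Strategy V := fun h =>
    if hg : ∃ e, IsGoodMove F G h e then hg.choose
    else if hu : ∃ e, IsUncolored G h e then hu.choose else e₀
  have hσ : ∀ h, (∃ e, IsGoodMove F G h e) → IsGoodMove F G h (σ h) := fun h hg => by
    simp only [σ, dif_pos hg]; exact hg.choose_spec
  refine ⟨σ, fun h hu => ?_, fun τ hτ => ?_⟩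
  · by_cases hg : ∃ e, IsGoodMove F G h e
    · exact (hσ h hg).1
    · simp only [σ, dif_neg hg, dif_pos hu]; exact hu.choose_spec
  have main : ∀ n t, {e | IsUncolored G (play G σ τ t) e}.ncard ≤ n →
      Even (play G σ τ t).length →
      AliceForces F G (blue (play G σ τ t)) (red (play G σ τ t)) → AliceWins F G σ τ := by
    intro n
    induction n with
    | zero =>
      intro t hn hev hA
      obtain ⟨e, he, -⟩ := hA.exists_isGoodMove
      have : e ∈ {e | IsUncolored G (play G σ τ t) e} := he
      rw [Nat.le_zero, Set.ncard_eq_zero] at hn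
      rw [hn] at this
      exact this.elim
    | succ n ih =>
      intro t hn hev hA
      obtain ⟨hu, hgood⟩ := hσ _ hA.exists_isGoodMove
      have h1 := play_succ_of_even (σ := σ) (τ := τ) ⟨_, hu⟩ hev
      have hb1 : blue (play G σ τ (t + 1))
          = insert (σ (play G σ τ t)) (blue (play G σ τ t)) := by
        rw [h1, blue, if_pos hev]
      have hr1 : red (play G σ τ (t + 1)) = red (play G σ τ t) := by
        rw [h1, red, if_pos hev]
      have hodd : ¬ Even (play G σ τ (t + 1)).length := by
        rw [h1, List.length_cons, Nat.even_add_one]; exact not_not.2 hev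
      rcases hgood with ⟨hB, hR⟩ | ⟨hex, hall⟩
      · exact ⟨t + 1, by rwa [hb1], by rwa [hr1]⟩
      · rw [← h1] at hex hall
        have h2 := play_succ_of_not_even (σ := σ) (τ := τ) hex hodd
        have huf := hτ _ hex
        refine ih (t + 2) ?_ ?_ ?_
        · refine Nat.le_of_lt_succ (lt_of_lt_of_le (Set.ncard_lt_ncard ?_ (Set.toFinite _)) hn)
          rw [Set.ssubset_iff_exists]
          refine ⟨fun e he => ⟨he.1, fun hmem => he.2 ?_⟩, _, hu, fun he => he.2 ?_⟩
          · rw [h2, h1]; simp [hmem]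
          · rw [h2, h1]; simp
        · rw [h2, List.length_cons, Nat.even_add_one]; exact hodd
        · rw [h2, blue, red, if_neg hodd, if_neg hodd, hb1, hr1]
          exact hall _ huf
  exact main _ 0 le_rfl (by simp [play]) (by simpa [play, blue, red] using hf)

end Forcing

/-! ### Bob's pairing strategy -/

section Pairing

/-- If every copy of `F` contains two edges paired by the involution `c`, then Bob prevents Alice
from winning by always answering with the paired edge. -/
theorem not_aliceHasWinningStrategy_of_pairing [Nonempty V] {F : SimpleGraph W}
    {G : SimpleGraph V} (c : Sym2 V → Sym2 V) (hcG : ∀ e ∈ G.edgeSet, c e ∈ G.edgeSet)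
    (hcc : ∀ e ∈ G.edgeSet, c (c e) = e) (hne : ∀ e ∈ G.edgeSet, c e ≠ e)
    (hF : ∀ E ⊆ G.edgeSet, ContainsCopy F E → ∃ e ∈ E, c e ∈ E) :
    ¬ AliceHasWinningStrategy F G := by
  classical
  rintro ⟨σ, hσ, hwin⟩
  let e₀ : Sym2 V := s(Classical.arbitrary V, Classical.arbitrary V)
  let other : Strategy V := fun h => if hu : ∃ e, IsUncolored G h e then hu.choose else e₀
  have hother : other.IsLegal G := fun h hu => by
    simp only [other, dif_pos hu]; exact hu.choose_spec
  let τ : Strategy V := fun h => match h with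
    | [] => other []
    | e :: h => if IsUncolored G (e :: h) (c e) then c e else other (e :: h)
  have hτc : ∀ e h, IsUncolored G (e :: h) (c e) → τ (e :: h) = c e := fun e h he => by
    simp only [τ, if_pos he]
  have hτ : τ.IsLegal G := by
    intro h hu
    cases h with
    | nil => exact hother _ hu
    | cons e h =>
      by_cases he : IsUncolored G (e :: h) (c e)
      · rw [hτc _ _ he]; exact he
      · simp only [τ, if_neg he]; exact hother _ hu
  -- The invariant when Alice is to move. Closure under `c` guarantees that the partner of her next
  -- edge is still free.
  let Paired : History V → Prop := fun h => Even h.length ∧ (∀ e ∈ h, e ∈ G.edgeSet) ∧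
    (∀ e ∈ h, c e ∈ h) ∧ ∀ e ∈ blue h, c e ∉ blue h
  have inv : ∀ t, Paired (play G σ τ t) ∨
      ∃ e h, play G σ τ t = e :: h ∧ IsUncolored G h e ∧ Paired h := by
    intro t
    induction t with
    | zero => left; simp [Paired, play, blue]
    | succ t ih =>
      by_cases hex : ∃ e, IsUncolored G (play G σ τ t) e
      swap
      · rwa [play_succ_of_full hex]
      rcases ih with hP | ⟨e, h, hplay, he, hP⟩
      · right
        exact ⟨_, _, play_succ_of_even hex hP.1, hσ _ hex, hP⟩
      · left
        obtain ⟨hev, hG, hc, hb⟩ := hP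
        have hce : c e ∉ h := fun hm => he.2 (hcc e he.1 ▸ hc _ hm)
        have hu : IsUncolored G (e :: h) (c e) :=
          ⟨hcG e he.1, by simp [hne e he.1, hce]⟩
        have hodd : ¬ Even (e :: h).length := by
          rw [List.length_cons, Nat.even_add_one]; exact not_not.2 hev
        have hstep : play G σ τ (t + 1) = c e :: e :: h := by
          rw [play_succ_of_not_even hex (by rwa [hplay]), hplay, hτc _ _ hu]
        rw [hstep]
        refine ⟨?_, ?_, ?_, ?_⟩
        · rw [List.length_cons, Nat.even_add_one]; exact hodd
        · simp only [List.mem_cons]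
          rintro f (rfl | rfl | hf)
          exacts [hcG _ he.1, he.1, hG _ hf]
        · simp only [List.mem_cons]
          rintro f (rfl | rfl | hf)
          exacts [Or.inr (Or.inl (hcc _ he.1)), Or.inl rfl, Or.inr (Or.inr (hc _ hf))]
        · have hsub : ∀ f ∈ blue h, f ∈ h := fun f hf => (mem_iff_blue_or_red h f).2 (Or.inl hf)
          rw [blue, if_neg hodd, blue, if_pos hev]
          rintro f (rfl | hf) (h' | h')
          · exact hne _ he.1 h'
          · exact hce (hsub _ h')
          · exact he.2 (h' ▸ hc _ (hsub _ hf))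
          · exact hb _ hf h'
  obtain ⟨t, ht, -⟩ := hwin τ hτ
  -- Blue contains no pair at either parity: a fresh edge of Alice has its partner uncolored.
  rcases inv t with ⟨-, hG, -, hb⟩ | ⟨e, h, hplay, he, hev, hG, hc, hb⟩
  · obtain ⟨f, hf, hcf⟩ := hF _ (fun f hf => hG _ ((mem_iff_blue_or_red _ f).2 (Or.inl hf))) ht
    exact hb _ hf hcf
  · have hsub : ∀ f ∈ blue h, f ∈ h := fun f hf => (mem_iff_blue_or_red h f).2 (Or.inl hf)
    rw [hplay, blue, if_pos hev] at ht
    obtain ⟨f, hf, hcf⟩ := hF _ (Set.insert_subset he.1 fun f hf => hG _ (hsub f hf)) ht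
    have hce : c e ∉ h := fun hm => he.2 (hcc e he.1 ▸ hc _ hm)
    rcases hf with rfl | hf <;> rcases hcf with h' | h'
    · exact hne _ he.1 h'
    · exact hce (hsub _ h')
    · exact he.2 (h' ▸ hc _ (hsub _ hf))
    · exact hb _ hf h'

end Pairing

/-! ### Matchings as finite edge sets: extension, rotation, bounds on red matchings -/

section Matchings

/-- The edges of `M` are pairwise disjoint and none of them is a loop. -/
def IsMatchingSet (M : Finset (Sym2 V)) : Prop :=
  (∀ e ∈ M, ¬ e.IsDiag) ∧ ∀ e ∈ M, ∀ f ∈ M, ∀ v, v ∈ e → v ∈ f → e = f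

/-- The vertex `v` is an endpoint of an edge of `M`. -/
def IsCovered (M : Finset (Sym2 V)) (v : V) : Prop := ∃ e ∈ M, v ∈ e

/-- Replaces embeddings by sets of disjoint edges, which can be extended, exchanged and counted. -/
theorem containsCopy_matching_iff [DecidableEq V] {m : ℕ} {E : Set (Sym2 V)} :
    ContainsCopy (matching m) E ↔
      ∃ M : Finset (Sym2 V), ↑M ⊆ E ∧ IsMatchingSet M ∧ M.card = m := by
  constructor
  · rintro ⟨φ⟩
    have hinj : ∀ i j : Fin m, ∀ v, v ∈ s(φ (i, 0), φ (i, 1)) → v ∈ s(φ (j, 0), φ (j, 1)) →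
        i = j := by
      intro i j v hi hj
      rw [Sym2.mem_iff] at hi hj
      rcases hi with rfl | rfl <;> rcases hj with h | h <;>
        exact congrArg Prod.fst (φ.injective h)
    have hadj : ∀ i : Fin m, (SimpleGraph.fromEdgeSet E).Adj (φ (i, 0)) (φ (i, 1)) := fun i =>
      φ.toHom.map_adj (show (matching m).Adj (i, 0) (i, 1) from ⟨rfl, Fin.zero_ne_one⟩)
    refine ⟨Finset.univ.image fun i : Fin m => s(φ (i, 0), φ (i, 1)), ?_, ⟨?_, ?_⟩, ?_⟩
    · intro e he
      obtain ⟨i, -, rfl⟩ := Finset.mem_image.1 (Finset.mem_coe.1 he)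
      exact ((SimpleGraph.fromEdgeSet_adj _).1 (hadj i)).1
    · intro e he
      obtain ⟨i, -, rfl⟩ := Finset.mem_image.1 he
      exact fun h => (hadj i).ne (Sym2.mk_isDiag_iff.1 h)
    · intro e he f hf v hve hvf
      obtain ⟨i, -, rfl⟩ := Finset.mem_image.1 he
      obtain ⟨j, -, rfl⟩ := Finset.mem_image.1 hf
      rw [hinj i j v hve hvf]
    · rw [Finset.card_image_of_injective, Finset.card_univ, Fintype.card_fin]
      intro i j hij
      refine hinj i j (φ (i, 0)) (Sym2.mem_mk_left _ _) ?_
      have hij' : s(φ (i, 0), φ (i, 1)) = s(φ (j, 0), φ (j, 1)) := hij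
      exact hij' ▸ Sym2.mem_mk_left _ _
  · rintro ⟨M, hME, ⟨hd, hdis⟩, hcard⟩
    let ε := (M.equivFinOfCardEq hcard).symm
    let φ : Fin m × Fin 2 → V := fun x =>
      if x.2 = 0 then (Quot.out (ε x.1).1).1 else (Quot.out (ε x.1).1).2
    have hout : ∀ e : Sym2 V, s((Quot.out e).1, (Quot.out e).2) = e := fun e => Quot.out_eq e
    have hmem : ∀ x, φ x ∈ (ε x.1).1 := by
      intro x
      by_cases hx : x.2 = 0
      · simp only [φ, if_pos hx]; exact Sym2.out_fst_mem _
      · simp only [φ, if_neg hx]; exact Sym2.out_snd_mem _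
    have hne : ∀ e ∈ M, (Quot.out e).1 ≠ (Quot.out e).2 := by
      intro e he h
      exact hd e he (by rw [← hout e]; exact Sym2.mk_isDiag_iff.2 h)
    refine ⟨⟨⟨φ, ?_⟩, ?_⟩⟩
    · rintro ⟨i, k⟩ ⟨j, l⟩ ⟨hij, hkl⟩
      obtain rfl : i = j := hij
      rw [SimpleGraph.fromEdgeSet_adj]
      have h1 := hne _ (ε i).2
      have h2 : s((Quot.out (ε i).1).1, (Quot.out (ε i).1).2) ∈ E := by
        rw [hout]; exact hME (ε i).2
      have hkl' : k ≠ l := hkl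
      by_cases hk : k = 0 <;> by_cases hl : l = 0
      · exact absurd (hk.trans hl.symm) hkl'
      · simp only [φ, hk, hl, if_true, if_false]; exact ⟨h2, h1⟩
      · simp only [φ, hk, hl, if_true, if_false]; exact ⟨Sym2.eq_swap ▸ h2, h1.symm⟩
      · omega
    · rintro ⟨i, k⟩ ⟨j, l⟩ h
      have h' : φ (i, k) = φ (j, l) := h
      have hij : i = j := ε.injective (Subtype.ext
        (hdis _ (ε i).2 _ (ε j).2 (φ (i, k)) (hmem (i, k)) (h' ▸ hmem (j, l))))
      subst hij
      have h1 := hne _ (ε i).2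
      by_cases hk : k = 0 <;> by_cases hl : l = 0
      · rw [hk, hl]
      · simp only [φ, hk, hl, if_true, if_false] at h'; exact absurd h' h1
      · simp only [φ, hk, hl, if_true, if_false] at h'; exact absurd h'.symm h1
      · have : k = l := by omega
        rw [this]

theorem two_mul_le_of_containsCopy_matching {m n : ℕ} {E : Set (Sym2 (Fin n))}
    (h : ContainsCopy (matching m) E) : 2 * m ≤ n := by
  obtain ⟨φ⟩ := h
  have := Fintype.card_le_of_injective _ φ.injective
  simp at this
  omega

theorem notMem_of_not_isCovered {M : Finset (Sym2 V)} {u v : V} (hu : ¬ IsCovered M u) :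
    s(u, v) ∉ M := fun h => hu ⟨_, h, Sym2.mem_mk_left _ _⟩

variable [DecidableEq V]

theorem IsMatchingSet.insert {M : Finset (Sym2 V)} (hM : IsMatchingSet M) {u v : V}
    (huv : u ≠ v) (hu : ¬ IsCovered M u) (hv : ¬ IsCovered M v) :
    IsMatchingSet (insert s(u, v) M) := by
  have key : ∀ e ∈ M, ∀ w, w ∈ s(u, v) → w ∈ e → False := by
    intro e he w hw hwe
    rcases Sym2.mem_iff.1 hw with rfl | rfl
    exacts [hu ⟨e, he, hwe⟩, hv ⟨e, he, hwe⟩]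
  refine ⟨fun e he => ?_, fun e he f hf w hwe hwf => ?_⟩
  · rcases Finset.mem_insert.1 he with rfl | he
    exacts [fun h => huv (Sym2.mk_isDiag_iff.1 h), hM.1 e he]
  · rcases Finset.mem_insert.1 he with rfl | he <;> rcases Finset.mem_insert.1 hf with rfl | hf
    · rfl
    · exact (key f hf w hwe hwf).elim
    · exact (key e he w hwf hwe).elim
    · exact hM.2 e he f hf w hwe hwf

theorem isCovered_insert {M : Finset (Sym2 V)} {u v w : V} :
    IsCovered (insert s(u, v) M) w ↔ w = u ∨ w = v ∨ IsCovered M w := by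
  simp [IsCovered, or_assoc]

theorem containsCopy_insert {m : ℕ} {E : Set (Sym2 V)} {M : Finset (Sym2 V)} {u v : V}
    (hM : IsMatchingSet M) (hcard : M.card + 1 = m) (hME : ↑M ⊆ E) (huv : u ≠ v)
    (hu : ¬ IsCovered M u) (hv : ¬ IsCovered M v) :
    ContainsCopy (matching m) (insert s(u, v) E) := by
  refine containsCopy_matching_iff.2 ⟨insert s(u, v) M, ?_, hM.insert huv hu hv, ?_⟩
  · rw [Finset.coe_insert]; exact Set.insert_subset_insert hME
  · rw [Finset.card_insert_of_notMem (notMem_of_not_isCovered hu), hcard]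

/-- Rotating a matching along a path `u`, `x`, `y` with `s(x, y) ∈ M` and `u` uncovered. -/
theorem IsMatchingSet.rotate {M : Finset (Sym2 V)} (hM : IsMatchingSet M) {u x y : V}
    (hxy : s(x, y) ∈ M) (hu : ¬ IsCovered M u) :
    IsMatchingSet (Insert.insert s(u, x) (M.erase s(x, y))) ∧
      (Insert.insert s(u, x) (M.erase s(x, y))).card = M.card ∧
      ∀ w, IsCovered (Insert.insert s(u, x) (M.erase s(x, y))) w →
        w = u ∨ (IsCovered M w ∧ w ≠ y) := by
  have hx : IsCovered M x := ⟨_, hxy, Sym2.mem_mk_left _ _⟩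
  have hne : x ≠ y := fun h => hM.1 _ hxy (Sym2.mk_isDiag_iff.2 h)
  have herase : ∀ w, IsCovered (M.erase s(x, y)) w → IsCovered M w ∧ w ≠ x ∧ w ≠ y := by
    rintro w ⟨e, he, hwe⟩
    obtain ⟨hexy, heM⟩ := Finset.mem_erase.1 he
    refine ⟨⟨e, heM, hwe⟩, ?_, ?_⟩
    · rintro rfl; exact hexy (hM.2 _ heM _ hxy w hwe (Sym2.mem_mk_left _ _))
    · rintro rfl; exact hexy (hM.2 _ heM _ hxy w hwe (Sym2.mem_mk_right _ _))
  have hM' : IsMatchingSet (M.erase s(x, y)) :=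
    ⟨fun e he => hM.1 e (Finset.mem_of_mem_erase he), fun e he f hf =>
      hM.2 e (Finset.mem_of_mem_erase he) f (Finset.mem_of_mem_erase hf)⟩
  have hu' : ¬ IsCovered (M.erase s(x, y)) u := fun h => hu (herase u h).1
  refine ⟨hM'.insert (fun h => hu (h ▸ hx)) hu' fun h => (herase x h).2.1 rfl, ?_, fun w hw => ?_⟩
  · rw [Finset.card_insert_of_notMem (notMem_of_not_isCovered hu'), Finset.card_erase_add_one hxy]
  · rcases isCovered_insert.1 hw with rfl | rfl | hw
    · exact Or.inl rfl
    · exact Or.inr ⟨hx, hne⟩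
    · exact Or.inr ⟨(herase w hw).1, (herase w hw).2.2⟩

/-- Edges of `R` through a common vertex contribute at most one edge to a matching. -/
theorem not_containsCopy_of_star {m : ℕ} {R T : Finset (Sym2 V)} {a : V} (hT : T ⊆ R)
    (ha : ∀ e ∈ T, a ∈ e) (hcard : R.card + 1 < T.card + m) :
    ¬ ContainsCopy (matching m) (R : Set (Sym2 V)) := by
  intro h
  obtain ⟨M, hMR, hM, rfl⟩ := containsCopy_matching_iff.1 h
  have h1 : (M ∩ T).card ≤ 1 := Finset.card_le_one.2 fun e he f hf =>
    hM.2 e (Finset.mem_inter.1 he).1 f (Finset.mem_inter.1 hf).1 a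
      (ha e (Finset.mem_inter.1 he).2) (ha f (Finset.mem_inter.1 hf).2)
  have h2 : (M \ T).card ≤ (R \ T).card :=
    Finset.card_le_card (Finset.sdiff_subset_sdiff (Finset.coe_subset.1 hMR) subset_rfl)
  have h3 := Finset.card_inter_add_card_sdiff M T
  have h4 := Finset.card_sdiff_add_card_eq_card hT
  omega

theorem not_containsCopy_of_card_lt {m : ℕ} {R : Finset (Sym2 V)} (hcard : R.card < m) :
    ¬ ContainsCopy (matching m) (R : Set (Sym2 V)) := by
  intro h
  obtain ⟨M, hMR, -, rfl⟩ := containsCopy_matching_iff.1 h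
  exact absurd (Finset.card_le_card (Finset.coe_subset.1 hMR)) (not_le.2 hcard)

open Classical in
theorem IsMatchingSet.card_isCovered [Fintype V] {M : Finset (Sym2 V)} (hM : IsMatchingSet M) :
    (Finset.univ.filter (IsCovered M)).card = 2 * M.card := by
  have : Finset.univ.filter (IsCovered M) = M.biUnion Sym2.toFinset := by
    ext v; simp [IsCovered]
  rw [this, Finset.card_biUnion, Finset.sum_const_nat (m := 2), mul_comm]
  · exact fun e he => Sym2.card_toFinset_of_not_isDiag _ (hM.1 e he)
  · intro e he f hf hef
    refine Finset.disjoint_left.2 ?_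
    intro v hv hv'
    exact hef (hM.2 e he f hf v (Sym2.mem_toFinset.1 hv) (Sym2.mem_toFinset.1 hv'))

end Matchings

/-! ### The endgame: Alice's matching misses two vertices -/

section PerfectMatching

variable {V : Type*}

theorem mem_edgeSet_top_of_ne {u v : V} (h : u ≠ v) : s(u, v) ∈ (⊤ : SimpleGraph V).edgeSet := by
  simpa using h

/-- The partner function of a matching. -/
theorem IsMatchingSet.exists_partner {M : Finset (Sym2 V)} (hM : IsMatchingSet M) :
    ∃ p : V → V, (∀ x, IsCovered M x → s(x, p x) ∈ M) ∧
      (∀ x, IsCovered M x → IsCovered M (p x)) ∧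
      ∀ x, IsCovered M x → ∀ y, IsCovered M y → p x = p y → x = y := by
  have hpart : ∀ x, ∃ y, IsCovered M x → s(x, y) ∈ M := fun x => by
    by_cases hx : IsCovered M x
    · obtain ⟨e, he, y, rfl⟩ := hx
      exact ⟨y, fun _ => he⟩
    · exact ⟨x, fun h => absurd h hx⟩
  choose p hp using hpart
  refine ⟨p, hp, fun x hx => ⟨_, hp x hx, Sym2.mem_mk_right _ _⟩, fun x hx y hy h => ?_⟩
  have := hM.2 _ (hp x hx) _ (hp y hy) (p x) (Sym2.mem_mk_right _ _)
    (h ▸ Sym2.mem_mk_right _ _)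
  rw [h] at this
  exact Sym2.congr_left.1 this

theorem sym2_ne_of_ne {a b c d : V} (h1 : a ≠ c) (h2 : a ≠ d) : s(a, b) ≠ s(c, d) := by
  intro h
  rcases Sym2.eq_iff.1 h with ⟨h, -⟩ | ⟨h, -⟩
  exacts [h1 h, h2 h]

variable [Fintype V] [DecidableEq V]

/-- Alice's double threat: `s(d, x₁)` and then `s(a, x₂)` extend the matching `M`, which misses
`a` and `d` only, while Bob has already three edges at `a`. -/
theorem aliceForces_of_forced_twice {m : ℕ} {M R : Finset (Sym2 V)} {a d a' x₁ y₁ : V}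
    (hm : 3 ≤ m) (hM : IsMatchingSet M) (hMcard : M.card + 1 = m) (hR : R.card = m)
    (ha : ¬ IsCovered M a) (hd : ¬ IsCovered M d) (had : a ≠ d) (hd' : a' ≠ d)
    (hRad : s(a, d) ∈ R) (hRaa' : s(a, a') ∈ R) (hRay : s(a, y₁) ∈ R) (hya' : y₁ ≠ a')
    (hxy : s(x₁, y₁) ∈ M) :
    AliceForces (matching m) ⊤ (insert s(d, x₁) (M : Set (Sym2 V))) R := by
  classical
  obtain ⟨p, hp, hpc, hedge⟩ := hM.exists_partner
  have hx₁ : IsCovered M x₁ := ⟨_, hxy, Sym2.mem_mk_left _ _⟩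
  have hy₁ : IsCovered M y₁ := ⟨_, hxy, Sym2.mem_mk_right _ _⟩
  have hxyne : x₁ ≠ y₁ := fun h => hM.1 _ hxy (Sym2.mk_isDiag_iff.2 h)
  have hca : ∀ x, IsCovered M x → x ≠ a := fun x hx h => ha (h ▸ hx)
  have hcd : ∀ x, IsCovered M x → x ≠ d := fun x hx h => hd (h ▸ hx)
  -- a vertex `x` none of whose relevant edges is red
  obtain ⟨x, hx, hxx₁, hxy₁, hRa, hRd, hRy⟩ : ∃ x, IsCovered M x ∧ x ≠ x₁ ∧ x ≠ y₁ ∧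
      s(a, x) ∉ R ∧ s(d, p x) ∉ R ∧ s(y₁, p x) ∉ R := by
    -- Charge each bad `x` to a red edge that makes it bad. The charging `φ` is injective and avoids
    -- the red edges `ad` and `ay₁`, so `2m - 4 ≤ m - 2`, which fails for `m ≥ 3`.
    by_contra! hbad
    let S := ((Finset.univ.filter (IsCovered M)).erase x₁).erase y₁
    have hS : S.card + 2 = 2 * M.card := by
      have h1 := Finset.card_erase_add_one (s := Finset.univ.filter (IsCovered M)) (a := x₁)
        (by simpa using hx₁)
      have h2 := Finset.card_erase_add_one
        (s := (Finset.univ.filter (IsCovered M)).erase x₁) (a := y₁)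
        (by simpa using ⟨hxyne.symm, hy₁⟩)
      have h3 := hM.card_isCovered
      simp only [S]
      omega
    let φ : V → Sym2 V := fun x => if s(a, x) ∈ R then s(a, x) else
      if s(d, p x) ∈ R then s(d, p x) else s(y₁, p x)
    have hmem : ∀ x ∈ S, IsCovered M x ∧ x ≠ x₁ ∧ x ≠ y₁ := by
      intro x hx
      simp only [S, Finset.mem_erase, Finset.mem_filter] at hx
      exact ⟨hx.2.2.2, hx.2.1, hx.1⟩
    have hle : S.card ≤ ((R.erase s(a, d)).erase s(a, y₁)).card := by
      refine Finset.card_le_card_of_injOn φ ?_ ?_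
      · intro x hx
        obtain ⟨hxc, hx1, hx2⟩ := hmem x hx
        rw [Finset.mem_coe, Finset.mem_erase, Finset.mem_erase]
        simp only [φ]
        split_ifs with h1 h2
        · exact ⟨fun h => hx2 (Sym2.congr_right.1 h), fun h => hcd x hxc (Sym2.congr_right.1 h), h1⟩
        · rw [Sym2.eq_swap (a := a) (b := y₁), Sym2.eq_swap (a := a) (b := d)]
          exact ⟨sym2_ne_of_ne (hcd _ hy₁).symm had.symm,
            fun h => hca _ (hpc _ hxc) (Sym2.congr_right.1 h), h2⟩
        · rw [Sym2.eq_swap (a := a) (b := y₁)]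
          exact ⟨fun h => hca _ (hpc _ hxc) (Sym2.congr_right.1 h),
            sym2_ne_of_ne (hca _ hy₁) (hcd _ hy₁), hbad x hxc hx1 hx2 h1 h2⟩
      · intro x hx z hz h
        obtain ⟨hxc, hx1, hx2⟩ := hmem x hx
        obtain ⟨hzc, hz1, hz2⟩ := hmem z hz
        have hay := hca _ hy₁
        have hdy := hcd _ hy₁
        simp only [φ] at h
        split_ifs at h
        · exact Sym2.congr_right.1 h
        · exact absurd h (sym2_ne_of_ne had (hca _ (hpc _ hzc)).symm)
        · exact absurd h (sym2_ne_of_ne hay.symm (hca _ (hpc _ hzc)).symm)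
        · exact absurd h.symm (sym2_ne_of_ne had (hca _ (hpc _ hxc)).symm)
        · exact hedge x hxc z hzc (Sym2.congr_right.1 h)
        · exact absurd h (sym2_ne_of_ne hdy.symm (hcd _ (hpc _ hzc)).symm)
        · exact absurd h.symm (sym2_ne_of_ne hay.symm (hca _ (hpc _ hxc)).symm)
        · exact absurd h.symm (sym2_ne_of_ne hdy.symm (hcd _ (hpc _ hxc)).symm)
        · exact hedge x hxc z hzc (Sym2.congr_right.1 h)
    have h1 := Finset.card_erase_add_one hRad
    have h2 := Finset.card_erase_add_one (s := R.erase s(a, d)) (a := s(a, y₁))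
      (Finset.mem_erase.2 ⟨fun h => hcd _ hy₁ (Sym2.congr_right.1 h), hRay⟩)
    omega
  generalize hy : p x = y at *
  have hxyM : s(x, y) ∈ M := hy ▸ hp x hx
  have hyc : IsCovered M y := ⟨_, hxyM, Sym2.mem_mk_right _ _⟩
  have hneM : s(x, y) ≠ s(x₁, y₁) := sym2_ne_of_ne hxx₁ hxy₁
  have hyy₁ : y ≠ y₁ := fun h => hneM (hM.2 _ hxyM _ hxy y (Sym2.mem_mk_right _ _)
    (h ▸ Sym2.mem_mk_right _ _))
  have hyx₁ : y ≠ x₁ := fun h => hneM (hM.2 _ hxyM _ hxy y (Sym2.mem_mk_right _ _)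
    (h ▸ Sym2.mem_mk_left _ _))
  have hyx : y ≠ x := fun h => hM.1 _ hxyM (Sym2.mk_isDiag_iff.2 h.symm)
  -- the three relevant edges are not blue
  have hB1 : s(a, x) ∉ insert s(d, x₁) (M : Set (Sym2 V)) := by
    rintro (h | h)
    exacts [sym2_ne_of_ne had (hca _ hx₁).symm h, notMem_of_not_isCovered ha h]
  have hB2 : s(d, y) ∉ insert s(a, x) (insert s(d, x₁) (M : Set (Sym2 V))) := by
    rintro (h | h | h)
    exacts [sym2_ne_of_ne had.symm (hcd _ hx).symm h, hyx₁ (Sym2.congr_right.1 h),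
      notMem_of_not_isCovered hd h]
  have hB3 : s(y₁, y) ∉ insert s(a, x) (insert s(d, x₁) (M : Set (Sym2 V))) := by
    rintro (h | h | h)
    · exact sym2_ne_of_ne (hca _ hy₁) hxy₁.symm h
    · exact sym2_ne_of_ne (hcd _ hy₁) hxyne.symm h
    · exact hyx₁ (Sym2.congr_right.1 ((hM.2 _ h _ hxy y₁ (Sym2.mem_mk_left _ _)
        (Sym2.mem_mk_right _ _)).trans Sym2.eq_swap))
  -- Three exchanged matchings: `N` (`ax` for `xy`) misses `d, y`; `L` (`dx₁` for `x₁y₁`) misses `a,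
  -- y₁`; `K` makes both exchanges and misses `y₁, y`.
  obtain ⟨hN, hNcard, hNcov⟩ := hM.rotate hxyM ha
  obtain ⟨hL, hLcard, hLcov⟩ := hM.rotate hxy hd
  have haL : ¬ IsCovered (insert s(d, x₁) (M.erase s(x₁, y₁))) a := fun h =>
    (hLcov a h).elim had fun h => ha h.1
  have hxyL : s(x, y) ∈ insert s(d, x₁) (M.erase s(x₁, y₁)) :=
    Finset.mem_insert_of_mem (Finset.mem_erase.2 ⟨hneM, hxyM⟩)
  obtain ⟨hK, hKcard, hKcov⟩ := hL.rotate hxyL haL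
  refine AliceForces.move s(a, x) (mem_edgeSet_top_of_ne (hca _ hx).symm) hB1 hRa
    ⟨s(d, y), mem_edgeSet_top_of_ne (hcd _ hyc).symm, hB2, hRd⟩ fun f _ hfB hfR => ?_
  -- Bob has `m + 1` edges, three of them at `a`, hence a matching of at most `m - 1`.
  have hnoR : ¬ ContainsCopy (matching m) (insert f (R : Set (Sym2 V))) := by
    rw [← Finset.coe_insert]
    refine not_containsCopy_of_star (T := {s(a, d), s(a, a'), s(a, y₁)}) (a := a) ?_ ?_ ?_
    · intro e he
      simp only [Finset.mem_insert, Finset.mem_singleton] at he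
      rcases he with rfl | rfl | rfl <;> exact Finset.mem_insert_of_mem ‹_›
    · intro e he
      simp only [Finset.mem_insert, Finset.mem_singleton] at he
      rcases he with rfl | rfl | rfl <;> exact Sym2.mem_mk_left _ _
    · rw [Finset.card_insert_of_notMem hfR, Finset.card_eq_three.2 ⟨_, _, _, ?_, ?_, ?_, rfl⟩]
      · omega
      · exact fun h => hd' (Sym2.congr_right.1 h).symm
      · exact fun h => hcd _ hy₁ (Sym2.congr_right.1 h).symm
      · exact fun h => hya' (Sym2.congr_right.1 h).symm
  by_cases hf : f = s(d, y)
  · subst hf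
    refine AliceForces.finish s(y₁, y) (mem_edgeSet_top_of_ne hyy₁.symm) hB3 ?_ ?_ hnoR
    · rintro (h | h)
      exacts [sym2_ne_of_ne (hcd _ hy₁) hyy₁.symm h, hRy h]
    · refine containsCopy_insert hK (by omega) ?_ hyy₁.symm ?_ ?_
      · rw [Finset.coe_insert]
        refine Set.insert_subset_insert fun e he => ?_
        have he' := Finset.mem_of_mem_erase (Finset.mem_coe.1 he)
        rcases Finset.mem_insert.1 he' with rfl | he'
        exacts [Or.inl rfl, Or.inr (Finset.mem_of_mem_erase he')]
      · intro h
        rcases hKcov _ h with h | ⟨h, -⟩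
        · exact hca _ hy₁ h
        · rcases hLcov _ h with h | ⟨-, h⟩
          exacts [hcd _ hy₁ h, h rfl]
      · intro h
        rcases hKcov _ h with h | ⟨-, h⟩
        exacts [hca _ hyc h, h rfl]
  · refine AliceForces.finish s(d, y) (mem_edgeSet_top_of_ne (hcd _ hyc).symm) hB2 ?_ ?_ hnoR
    · rintro (h | h)
      exacts [hf h.symm, hRd h]
    · refine containsCopy_insert hN (by omega) ?_ (hcd _ hyc).symm ?_ ?_
      · rw [Finset.coe_insert]
        exact Set.insert_subset_insert fun e he => Or.inr (Finset.mem_of_mem_erase he)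
      · intro h
        rcases hNcov _ h with h | ⟨h, -⟩
        exacts [had h.symm, hd h]
      · intro h
        rcases hNcov _ h with h | ⟨-, h⟩
        exacts [hca _ hyc h, h rfl]

/-- Alice's matching `M` misses `a` and `d` only, and Bob has answered at `s(a, d)`. -/
theorem aliceForces_of_forced_once {m : ℕ} {M R : Finset (Sym2 V)} {a d a' : V}
    (hm : 3 ≤ m) (hM : IsMatchingSet M) (hMcard : M.card + 1 = m) (hR : R.card + 1 = m)
    (ha : ¬ IsCovered M a) (hd : ¬ IsCovered M d) (had : a ≠ d) (hd' : a' ≠ d)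
    (hRad : s(a, d) ∈ R) (hRaa' : s(a, a') ∈ R) :
    AliceForces (matching m) ⊤ (M : Set (Sym2 V)) R := by
  classical
  obtain ⟨p, hp, hpc, hedge⟩ := hM.exists_partner
  have hca : ∀ x, IsCovered M x → x ≠ a := fun x hx h => ha (h ▸ hx)
  have hcd : ∀ x, IsCovered M x → x ≠ d := fun x hx h => hd (h ▸ hx)
  obtain ⟨x, hx, hRd, hRa⟩ : ∃ x, IsCovered M x ∧ s(d, x) ∉ R ∧ s(a, p x) ∉ R := by
    -- The same charging: all `2(m - 1)` covered vertices would inject into the `m - 1` red edges.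
    by_contra! hbad
    let S := Finset.univ.filter (IsCovered M)
    have hS : S.card = 2 * M.card := hM.card_isCovered
    let φ : V → Sym2 V := fun x => if s(d, x) ∈ R then s(d, x) else s(a, p x)
    have hmem : ∀ x ∈ S, IsCovered M x := fun x hx => (Finset.mem_filter.1 hx).2
    have hle : S.card ≤ R.card := by
      refine Finset.card_le_card_of_injOn φ ?_ ?_
      · intro x hx
        rw [Finset.mem_coe]
        simp only [φ]
        split_ifs with h1
        · exact h1
        · exact hbad x (hmem x hx) h1
      · intro x hx z hz h
        have hxc := hmem x hx
        have hzc := hmem z hz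
        simp only [φ] at h
        split_ifs at h
        · exact Sym2.congr_right.1 h
        · exact absurd h (sym2_ne_of_ne had.symm (hcd _ (hpc _ hzc)).symm)
        · exact absurd h.symm (sym2_ne_of_ne had.symm (hcd _ (hpc _ hxc)).symm)
        · exact hedge x hxc z hzc (Sym2.congr_right.1 h)
    omega
  generalize hy : p x = y at *
  have hxyM : s(x, y) ∈ M := hy ▸ hp x hx
  have hyc : IsCovered M y := ⟨_, hxyM, Sym2.mem_mk_right _ _⟩
  have hB2 : s(a, y) ∉ insert s(d, x) (M : Set (Sym2 V)) := by
    rintro (h | h)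
    exacts [sym2_ne_of_ne had (hca _ hx).symm h, notMem_of_not_isCovered ha h]
  refine AliceForces.move s(d, x) (mem_edgeSet_top_of_ne (hcd _ hx).symm)
    (notMem_of_not_isCovered hd) hRd
    ⟨s(a, y), mem_edgeSet_top_of_ne (hca _ hyc).symm, hB2, hRa⟩ fun f _ hfB hfR => ?_
  by_cases hf : f = s(a, y)
  · subst hf
    rw [← Finset.coe_insert s(a, y)]
    exact aliceForces_of_forced_twice hm hM hMcard
      (by rw [Finset.card_insert_of_notMem hRa, hR]) ha hd had hd'
      (Finset.mem_insert_of_mem hRad) (Finset.mem_insert_of_mem hRaa')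
      (Finset.mem_insert_self _ _) (fun h => hRa (h ▸ hRaa')) hxyM
  · obtain ⟨hN, hNcard, hNcov⟩ := hM.rotate hxyM hd
    refine AliceForces.finish s(a, y) (mem_edgeSet_top_of_ne (hca _ hyc).symm) hB2 ?_ ?_ ?_
    · rintro (h | h)
      exacts [hf h.symm, hRa h]
    · refine containsCopy_insert hN (by omega) ?_ (hca _ hyc).symm ?_ ?_
      · rw [Finset.coe_insert]
        exact Set.insert_subset_insert fun e he => Finset.mem_of_mem_erase he
      · intro h
        rcases hNcov _ h with h | ⟨h, -⟩
        exacts [had h, ha h]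
      · intro h
        rcases hNcov _ h with h | ⟨-, h⟩
        exacts [hcd _ hyc h, h rfl]
    -- Bob has `m` edges, two of them at `a`, hence a matching of at most `m - 1`.
    · rw [← Finset.coe_insert]
      refine not_containsCopy_of_star (T := {s(a, d), s(a, a')}) (a := a) ?_ ?_ ?_
      · intro e he
        simp only [Finset.mem_insert, Finset.mem_singleton] at he
        rcases he with rfl | rfl <;> exact Finset.mem_insert_of_mem ‹_›
      · intro e he
        simp only [Finset.mem_insert, Finset.mem_singleton] at he
        rcases he with rfl | rfl <;> exact Sym2.mem_mk_left _ _
      · rw [Finset.card_insert_of_notMem hfR, Finset.card_pair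
          (fun h => hd' (Sym2.congr_right.1 h).symm)]
        omega

end PerfectMatching

/-! ### The opening: reaching the endgame with Bob's edges gathered at `a` -/

section Opening

variable {V : Type*}

theorem isMatchingSet_empty : IsMatchingSet (∅ : Finset (Sym2 V)) := by simp [IsMatchingSet]

theorem not_isCovered_empty (v : V) : ¬ IsCovered (∅ : Finset (Sym2 V)) v := by simp [IsCovered]

theorem exists_mem_notMem_of_ne {x y : V} {f : Sym2 V} (hf : ¬ f.IsDiag) (hne : f ≠ s(x, y)) :
    ∃ a ∈ f, a ≠ x ∧ a ≠ y := by
  by_contra! h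
  induction f with | _ u v =>
  have hu := h u (Sym2.mem_mk_left _ _)
  have hv := h v (Sym2.mem_mk_right _ _)
  have huv : u ≠ v := fun h => hf (Sym2.mk_isDiag_iff.2 h)
  by_cases hux : u = x
  · by_cases hvx : v = x
    · exact huv (hux.trans hvx.symm)
    · exact hne (by rw [hux, hv hvx])
  · by_cases hvx : v = x
    · exact hne (by rw [hu hux, hvx, Sym2.eq_swap])
    · exact huv ((hu hux).trans (hv hvx).symm)

variable [Fintype V] [DecidableEq V]

/-- Alice plays disjoint edges that miss the vertex `a` of Bob's edge `s(a, a')`, so that at most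
one red edge joins vertices missed by her matching `M`. -/
theorem aliceForces_of_matching {m : ℕ} (hm : 3 ≤ m) (hV : Fintype.card V = 2 * m) {a a' : V}
    (j : ℕ) (M R : Finset (Sym2 V)) (hM : IsMatchingSet M) (hMcard : M.card + 2 + j = m)
    (hR : R.card = M.card) (ha : ¬ IsCovered M a) (hRaa' : s(a, a') ∈ R)
    (hRd : ∀ e ∈ R, ¬ e.IsDiag)
    (hRU : ∀ e ∈ R, ∀ f ∈ R, (∀ v ∈ e, ¬ IsCovered M v) → (∀ v ∈ f, ¬ IsCovered M v) → e = f) :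
    AliceForces (matching m) ⊤ (M : Set (Sym2 V)) R := by
  classical
  have hU : ((Finset.univ.filter fun v => ¬ IsCovered M v).erase a).card = 2 * j + 3 := by
    have h1 := Finset.card_filter_add_card_filter_not (s := (Finset.univ : Finset V)) (IsCovered M)
    rw [hM.card_isCovered, Finset.card_univ, hV] at h1
    have h2 := Finset.card_erase_add_one (s := Finset.univ.filter fun v => ¬ IsCovered M v)
      (a := a) (by simpa using ha)
    omega
  have hmemU : ∀ v, v ∈ (Finset.univ.filter fun v => ¬ IsCovered M v).erase a ↔
      v ≠ a ∧ ¬ IsCovered M v := by simp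
  have hin : ∀ {u v : V}, ¬ IsCovered M u → ¬ IsCovered M v →
      ∀ w ∈ s(u, v), ¬ IsCovered M w := by
    intro u v hu hv w hw
    rcases Sym2.mem_iff.1 hw with rfl | rfl <;> assumption
  induction j generalizing M R with
  | zero =>
    -- Stated for every labelling of the last three vertices, since the split `bc`, `ad` must be
    -- free of red.
    have step : ∀ b c d, b ≠ a → c ≠ a → d ≠ a → b ≠ c → b ≠ d → c ≠ d → ¬ IsCovered M b →
        ¬ IsCovered M c → ¬ IsCovered M d → s(b, c) ∉ R → s(a, d) ∉ R →
        AliceForces (matching m) ⊤ (M : Set (Sym2 V)) R := by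
      intro b c d hba hca hda hbc hbd hcd hb hc hd hRbc hRad
      have hB : s(a, d) ∉ insert s(b, c) (M : Set (Sym2 V)) := by
        rintro (h | h)
        exacts [sym2_ne_of_ne hba.symm hca.symm h, notMem_of_not_isCovered ha h]
      have hM' := hM.insert hbc hb hc
      have hcard : (insert s(b, c) M).card = M.card + 1 :=
        Finset.card_insert_of_notMem (notMem_of_not_isCovered hb)
      have ha' : ¬ IsCovered (insert s(b, c) M) a := by
        rw [isCovered_insert]; rintro (h | h | h); exacts [hba h.symm, hca h.symm, ha h]
      have hd' : ¬ IsCovered (insert s(b, c) M) d := by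
        rw [isCovered_insert]; rintro (h | h | h); exacts [hbd h.symm, hcd h.symm, hd h]
      refine AliceForces.move s(b, c) (mem_edgeSet_top_of_ne hbc) (notMem_of_not_isCovered hb) hRbc
        ⟨s(a, d), mem_edgeSet_top_of_ne hda.symm, hB, hRad⟩ fun f _ hfB hfR => ?_
      by_cases hf : f = s(a, d)
      · subst hf
        rw [← Finset.coe_insert, ← Finset.coe_insert]
        exact aliceForces_of_forced_once hm hM' (by omega)
          (by rw [Finset.card_insert_of_notMem hRad]; omega) ha' hd' hda.symm
          (fun h => hRad (h ▸ hRaa')) (Finset.mem_insert_self _ _)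
          (Finset.mem_insert_of_mem hRaa')
      · refine AliceForces.finish s(a, d) (mem_edgeSet_top_of_ne hda.symm) hB ?_ ?_ ?_
        · rintro (h | h)
          exacts [hf h.symm, hRad h]
        · exact containsCopy_insert hM' (by omega) (by rw [Finset.coe_insert]) hda.symm ha' hd'
        · rw [← Finset.coe_insert]
          refine not_containsCopy_of_card_lt ?_
          rw [Finset.card_insert_of_notMem hfR]; omega
    obtain ⟨b, c, d, hbc, hbd, hcd, hU'⟩ := Finset.card_eq_three.1 hU
    obtain ⟨hba, hb⟩ := (hmemU b).1 (by rw [hU']; simp)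
    obtain ⟨hca, hc⟩ := (hmemU c).1 (by rw [hU']; simp)
    obtain ⟨hda, hd⟩ := (hmemU d).1 (by rw [hU']; simp)
    -- At most one red edge lies inside `{a, b, c, d}`; if it spoils this split, then `bd`, `ac` is
    -- clean.
    by_cases hred : s(b, c) ∈ R ∨ s(a, d) ∈ R
    · refine step b d c hba hda hca hbd hbc hcd.symm hb hd hc (fun h => ?_) fun h => ?_ <;>
        rcases hred with h' | h'
      · exact hcd (Sym2.congr_right.1 (hRU _ h' _ h (hin hb hc) (hin hb hd)))
      · exact sym2_ne_of_ne hba.symm hda.symm (hRU _ h' _ h (hin ha hd) (hin hb hd))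
      · exact sym2_ne_of_ne hba hbc (hRU _ h' _ h (hin hb hc) (hin ha hc))
      · exact hcd (Sym2.congr_right.1 (hRU _ h' _ h (hin ha hd) (hin ha hc))).symm
    · rw [not_or] at hred
      exact step b c d hba hca hda hbc hbd hcd hb hc hd hred.1 hred.2
  | succ j ih =>
    -- Covering `p` kills the only red edge among uncovered vertices, if there is one; afterwards
    -- only Bob's reply can be such an edge, which restores `hRU`.
    obtain ⟨p, q, hpq, hpa, hqa, hp, hq, hRpq, hcover⟩ : ∃ p q, p ≠ q ∧ p ≠ a ∧ q ≠ a ∧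
        ¬ IsCovered M p ∧ ¬ IsCovered M q ∧ s(p, q) ∉ R ∧
        ∀ e ∈ R, (∀ v ∈ e, ¬ IsCovered M v) → p ∈ e := by
      by_cases hred : ∃ e ∈ R, ∀ v ∈ e, ¬ IsCovered M v
      · obtain ⟨e, he, heU⟩ := hred
        obtain ⟨p, hpe, hpa⟩ : ∃ p ∈ e, p ≠ a := by
          by_contra! h
          induction e with | _ x y =>
          exact hRd _ he (Sym2.mk_isDiag_iff.2
            ((h x (Sym2.mem_mk_left _ _)).trans (h y (Sym2.mem_mk_right _ _)).symm))
        obtain ⟨r, rfl⟩ := hpe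
        obtain ⟨q, hqU, hq⟩ := Finset.exists_mem_notMem_of_card_lt_card (s := {p, r})
          (t := (Finset.univ.filter fun v => ¬ IsCovered M v).erase a)
          (by have := Finset.card_le_two (a := p) (b := r); omega)
        simp only [Finset.mem_insert, Finset.mem_singleton, not_or] at hq
        obtain ⟨hqa, hqM⟩ := (hmemU q).1 hqU
        have hpM := heU p (Sym2.mem_mk_left _ _)
        refine ⟨p, q, Ne.symm hq.1, hpa, hqa, hpM, hqM, fun h => hq.2 ?_, fun f hf hfU => ?_⟩
        · exact Sym2.congr_right.1 (hRU _ h _ he (hin hpM hqM) heU)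
        · rw [hRU f hf _ he hfU heU]; exact Sym2.mem_mk_left _ _
      · obtain ⟨p, hpU, q, hqU, hpq⟩ := Finset.one_lt_card.1 (show
          1 < ((Finset.univ.filter fun v => ¬ IsCovered M v).erase a).card by omega)
        obtain ⟨hpa, hpM⟩ := (hmemU p).1 hpU
        obtain ⟨hqa, hqM⟩ := (hmemU q).1 hqU
        exact ⟨p, q, hpq, hpa, hqa, hpM, hqM, fun h => hred ⟨_, h, hin hpM hqM⟩,
          fun e he heU => (hred ⟨e, he, heU⟩).elim⟩
    -- `z` serves only to show that Bob has a reply, namely `az`.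
    obtain ⟨z, hzU, hz⟩ := Finset.exists_mem_notMem_of_card_lt_card (s := {p, q})
      (t := (Finset.univ.filter fun v => ¬ IsCovered M v).erase a)
      (by have := Finset.card_le_two (a := p) (b := q); omega)
    simp only [Finset.mem_insert, Finset.mem_singleton, not_or] at hz
    obtain ⟨hza, hzM⟩ := (hmemU z).1 hzU
    have hcov := fun w => isCovered_insert (M := M) (u := p) (v := q) (w := w)
    refine AliceForces.move s(p, q) (mem_edgeSet_top_of_ne hpq) (notMem_of_not_isCovered hp) hRpq
      ⟨s(a, z), mem_edgeSet_top_of_ne hza.symm, ?_, fun h => ?_⟩ fun f hfG hfB hfR => ?_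
    · rintro (h | h)
      exacts [sym2_ne_of_ne hpa.symm hqa.symm h, notMem_of_not_isCovered ha h]
    · rcases Sym2.mem_iff.1 (hcover _ h (hin ha hzM)) with h | h
      exacts [hpa h, hz.1 h.symm]
    · have hcard : (insert s(p, q) M).card = M.card + 1 :=
        Finset.card_insert_of_notMem (notMem_of_not_isCovered hp)
      have ha' : ¬ IsCovered (insert s(p, q) M) a := by
        rw [isCovered_insert]; rintro (h | h | h); exacts [hpa h.symm, hqa h.symm, ha h]
      have hold : ∀ e ∈ R, (∀ v ∈ e, ¬ IsCovered (insert s(p, q) M) v) → False :=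
        fun e he heU => heU p
          (hcover e he fun v hv h => heU v hv ((hcov v).2 (Or.inr (Or.inr h))))
          ((hcov p).2 (Or.inl rfl))
      have hM' := hM.insert hpq hp hq
      rw [← Finset.coe_insert, ← Finset.coe_insert]
      refine ih (insert s(p, q) M) (insert f R) hM' (by omega)
        (by rw [Finset.card_insert_of_notMem hfR]; omega) ha' (Finset.mem_insert_of_mem hRaa')
        ?_ ?_ ?_ (by simp) ?_
      · intro e he
        rcases Finset.mem_insert.1 he with rfl | he
        exacts [by simpa using hfG, hRd e he]
      · intro e he g hg heU hgU
        rcases Finset.mem_insert.1 he with rfl | he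
        · rcases Finset.mem_insert.1 hg with rfl | hg
          exacts [rfl, (hold _ hg hgU).elim]
        · exact (hold _ he heU).elim
      · have h1 := Finset.card_filter_add_card_filter_not (s := (Finset.univ : Finset V))
          (IsCovered (insert s(p, q) M))
        rw [hM'.card_isCovered, Finset.card_univ, hV] at h1
        have h2 := Finset.card_erase_add_one
          (s := Finset.univ.filter fun v => ¬ IsCovered (insert s(p, q) M) v)
          (a := a) (by simpa using ha')
        omega
      · intro u v hu hv w hw
        rcases Sym2.mem_iff.1 hw with rfl | rfl <;> assumption

theorem aliceForces_matching_of_three_le {m : ℕ} (hm : 3 ≤ m) (hV : Fintype.card V = 2 * m) :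
    AliceForces (matching m) (⊤ : SimpleGraph V) ∅ ∅ := by
  obtain ⟨x, y, z, -, -, -, hxy, hxz, hyz⟩ := Finset.two_lt_card_iff.1
    (show 2 < (Finset.univ : Finset V).card by rw [Finset.card_univ]; omega)
  refine AliceForces.move s(x, y) (mem_edgeSet_top_of_ne hxy) (Set.notMem_empty _)
    (Set.notMem_empty _) ⟨s(z, x), mem_edgeSet_top_of_ne hxz.symm, ?_, Set.notMem_empty _⟩
    fun f hfG hfB _ => ?_
  · rintro (h | h)
    exacts [sym2_ne_of_ne hxz.symm hyz.symm h, h]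
  · have hfd : ¬ f.IsDiag := by simpa using hfG
    obtain ⟨a, ⟨a', rfl⟩, hax, hay⟩ := exists_mem_notMem_of_ne hfd fun h => hfB (Or.inl h)
    obtain ⟨j, rfl⟩ : ∃ j, m = 1 + 2 + j := ⟨m - 3, by omega⟩
    rw [← Finset.coe_empty, ← Finset.coe_insert, ← Finset.coe_insert]
    refine aliceForces_of_matching (a := a) (a' := a') hm hV j _ _
      (isMatchingSet_empty.insert hxy (not_isCovered_empty _) (not_isCovered_empty _))
      (by simp) (by simp) ?_ (Finset.mem_insert_self _ _) (by simpa using hfd) (by simp)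
    rw [isCovered_insert]
    rintro (h | h | h)
    exacts [hax h, hay h, not_isCovered_empty _ h]

end Opening

/-! ### The cases `m = 1` and `m = 2` -/

section SmallBoards

theorem aliceForces_matching_one : AliceForces (matching 1) (⊤ : SimpleGraph (Fin 2)) ∅ ∅ := by
  refine AliceForces.finish s(0, 1) (mem_edgeSet_top_of_ne (by decide)) (Set.notMem_empty _)
    (Set.notMem_empty _) ?_ ?_
  · exact containsCopy_insert isMatchingSet_empty (by simp) (by simp) (by decide)
      (not_isCovered_empty _) (not_isCovered_empty _)
  · rw [← Finset.coe_empty]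
    exact not_containsCopy_of_card_lt (by simp)

theorem aliceForces_matching_two : AliceForces (matching 2) (⊤ : SimpleGraph (Fin 5)) ∅ ∅ := by
  refine AliceForces.move s(0, 1) (mem_edgeSet_top_of_ne (by decide)) (Set.notMem_empty _)
    (Set.notMem_empty _) ⟨s(2, 3), mem_edgeSet_top_of_ne (by decide), ?_, Set.notMem_empty _⟩
    fun f hfG hfB _ => ?_
  · rintro (h | h)
    exacts [absurd h (by decide), h]
  -- Alice finishes at `s(2, 3)` or `s(2, 4)`, whichever Bob left free.
  have key : ∀ v : Fin 5, v ≠ 0 → v ≠ 1 → v ≠ 2 → f ≠ s(2, v) →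
      AliceForces (matching 2) (⊤ : SimpleGraph (Fin 5)) (insert s(0, 1) ∅) (insert f ∅) := by
    intro v h0 h1 h2 hf
    have hcov : ∀ w : Fin 5, w ≠ 0 → w ≠ 1 → ¬ IsCovered (insert s(0, 1) ∅) w := by
      intro w h0 h1 h
      rcases isCovered_insert.1 h with h | h | h
      exacts [h0 h, h1 h, not_isCovered_empty _ h]
    refine AliceForces.finish s(2, v) (mem_edgeSet_top_of_ne h2.symm) ?_ ?_ ?_ ?_
    · rintro (h | h)
      exacts [sym2_ne_of_ne (by decide) (by decide) h, h]
    · rintro (h | h)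
      exacts [hf h.symm, h]
    · exact containsCopy_insert (isMatchingSet_empty.insert (by decide) (not_isCovered_empty _)
        (not_isCovered_empty _)) (by simp) (by simp) h2.symm (hcov 2 (by decide) (by decide))
        (hcov v h0 h1)
    · rw [← Finset.coe_empty, ← Finset.coe_insert]
      exact not_containsCopy_of_card_lt (by simp)
  by_cases hf : f = s(2, 3)
  · exact key 4 (by decide) (by decide) (by decide) (by rw [hf]; decide)
  · exact key 3 (by decide) (by decide) (by decide) hf

theorem not_aliceHasWinningStrategy_matching_two :
    ¬ AliceHasWinningStrategy (matching 2) (⊤ : SimpleGraph (Fin 4)) := by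
  -- The pairing is by complementary edges; uniqueness of the complement makes it an involution and
  -- puts both edges of any `2K₂` in one pair.
  have hex : ∀ e : Sym2 (Fin 4), ∃ f : Sym2 (Fin 4), ¬ e.IsDiag → ¬ f.IsDiag ∧
      (∀ v, v ∈ e → v ∉ f) ∧
      ∀ g : Sym2 (Fin 4), ¬ g.IsDiag → (∀ v, v ∈ e → v ∉ g) → g = f := by
    intro e
    induction e with | _ x y =>
    have h : ∀ x y : Fin 4, x ≠ y → ∃ u v : Fin 4, u ≠ v ∧ (u ≠ x ∧ u ≠ y ∧ v ≠ x ∧ v ≠ y) ∧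
        ∀ w z : Fin 4, w ≠ z → w ≠ x ∧ w ≠ y ∧ z ≠ x ∧ z ≠ y →
          (w = u ∧ z = v ∨ w = v ∧ z = u) := by decide
    by_cases hxy : x = y
    · exact ⟨s(x, y), fun h => absurd (Sym2.mk_isDiag_iff.2 hxy) h⟩
    obtain ⟨u, v, huv, ⟨h1, h2, h3, h4⟩, h5⟩ := h x y hxy
    refine ⟨s(u, v), fun _ => ⟨fun h => huv (Sym2.mk_isDiag_iff.1 h), ?_, fun g hg hd => ?_⟩⟩
    · simp only [Sym2.mem_iff]
      rintro w (rfl | rfl) (rfl | rfl) <;> contradiction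
    · induction g with | _ w z =>
      have hx := hd x (Sym2.mem_mk_left _ _)
      have hy := hd y (Sym2.mem_mk_right _ _)
      simp only [Sym2.mem_iff, not_or] at hx hy
      exact Sym2.eq_iff.2 (h5 w z (fun h => hg (Sym2.mk_isDiag_iff.2 h))
        ⟨Ne.symm hx.1, Ne.symm hy.1, Ne.symm hx.2, Ne.symm hy.2⟩)
  choose c hc using hex
  have hG : ∀ e : Sym2 (Fin 4), e ∈ (⊤ : SimpleGraph (Fin 4)).edgeSet ↔ ¬ e.IsDiag := by simp
  simp only [← hG] at hc
  refine not_aliceHasWinningStrategy_of_pairing c (fun e he => (hc e he).1) (fun e he => ?_)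
    (fun e he h => ?_) fun E hE h => ?_
  · exact ((hc _ (hc e he).1).2.2 e he fun v hv hve => (hc e he).2.1 v hve hv).symm
  · have := (hc e he).2.1
    rw [h] at this
    induction e with | _ x y => exact this x (Sym2.mem_mk_left _ _) (Sym2.mem_mk_left _ _)
  · obtain ⟨M, hME, hM, hcard⟩ := containsCopy_matching_iff.1 h
    obtain ⟨e, f, hef, rfl⟩ := Finset.card_eq_two.1 hcard
    have he : e ∈ E := hME (by simp)
    have hf : f ∈ E := hME (by simp)
    refine ⟨e, he, ?_⟩
    rwa [← (hc e (hE he)).2.2 f (hE hf) fun v hve hvf =>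
      hef (hM.2 e (by simp) f (by simp) v hve hvf)]

end SmallBoards

end AchievementGame

/-- For every `m ≥ 1`, the achievement number of `mK₂` is `5` if `m = 2`, and `2m` otherwise. -/
theorem theorem3p1 (m : ℕ) (hm : 1 ≤ m) :
    AchievementGame.IsAchievementNumber (AchievementGame.matching m)
      (if m = 2 then 5 else 2 * m) := by
  have hlow : ∀ n : ℕ, AchievementGame.AliceHasWinningStrategy (AchievementGame.matching m)
      (⊤ : SimpleGraph (Fin n)) → 2 * m ≤ n := by
    rintro n ⟨σ, hσ, hwin⟩
    -- Any legal opponent will do; `σ` itself can play Bob's side.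
    obtain ⟨t, ht, -⟩ := hwin σ hσ
    exact AchievementGame.two_mul_le_of_containsCopy_matching ht
  split_ifs with h
  · subst h
    refine ⟨AchievementGame.aliceForces_matching_two.hasWinningStrategy, fun n hn => ?_⟩
    by_contra hlt
    obtain rfl : n = 4 := by have := hlow n hn; omega
    exact AchievementGame.not_aliceHasWinningStrategy_matching_two hn
  · refine ⟨?_, fun n hn => hlow n hn⟩
    by_cases h1 : m = 1
    · subst h1
      exact AchievementGame.aliceForces_matching_one.hasWinningStrategy
    · exact (AchievementGame.aliceForces_matching_of_three_le (by omega)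
        (by simp)).hasWinningStrategy
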